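/- **Corollary C.** Let $d\in\mathbb N$, write $[d]=\{1,\dots,d\}$, and let $(A,\alpha,\mathbb Z_+^d)$ be a C*-dynamical system, i.e. $A$ is a (not necessarily unital) C*-algebra and $\alpha\colon\mathbb Z_+^d\to\operatorname{End}(A)$, $\underline n\mapsto\alpha_{\underline n}$, is a unital semigroup homomorphism into the $*$-endomorphisms of $A$. Let $X_\alpha=\{X_{\alpha,\underline n}\}_{\underline n\in\mathbb Z_+^d}$ be the associated proper product system with coefficients in $A$: $X_{\alpha,\underline n}=[\alpha_{\underline n}(A)A]$ (closed linear span), with the right Hilbert $A$-module structure inherited from $A$ (so $\langle\xi,\eta\rangle=\xi^*\eta$), left action $\phi_{\underline n}(a)\xi=\alpha_{\underline n}(a)\xi$, and multiplication $X_{\alpha,\underline n}\otimes_A X_{\alpha,\underline m}\to X_{\alpha,\underline n+\underline m}$, $\xi\otimes\eta\mapsto\alpha_{\underline m}(\xi)\eta$. A $2^d$-tuple of a proper product system $X=\{X_{\underline n}\}_{\underline n\in\mathbb Z_+^d}$ with coefficients in $A$ is a family $\mathcal L=\{\mathcal L_F\}_{F\subseteq[d]}$ of non-empty subsets of $A$;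 $\mathcal K\subseteq\mathcal L$ means $\mathcal K_F\subseteq\mathcal L_F$ for all $F\subseteq[d]$. Ideals are two-sided and norm-closed. For an ideal $I\subseteq A$ put $X_{\underline n}^{-1}(I)=\{a\in A:\langle X_{\underline n},aX_{\underline n}\rangle\subseteq I\}$, and let $\underline i$ denote the $i$-th generator of $\mathbb Z_+^d$. Given $2^d$-tuples $\mathcal K$ and $\mathcal L$ of $X$, one says that $\mathcal L$ is a $\mathcal K$-relative O-family of $X$ if $\mathcal L$ consists of ideals, $\mathcal L_F=X_{\underline i}^{-1}(\mathcal L_F)\cap\mathcal L_{F\cup\{i\}}$ for all $F\subsetneq[d]$ and $i\in[d]\setminus F$ (that is, $\mathcal L$ is a T-family of $X$), and $\mathcal K\subseteq\mathcal L$. Let $\mathcal K$ and $\mathcal L$ be $2^d$-tuples of $X_\alpha$. Then $\mathcal L$ is a $\mathcal K$-relative O-family of $X_\alpha$ if and only if the following three conditions hold: 1. $\mathcal L$ consists of ideals; 2. $\mathcal L_F=\alpha_{\underline i}^{-1}(\mathcal L_F)\cap\mathcal L_{F\cup\{i\}}$ for all $F\subsetneq[d]$ and $i\in[d]\setminus F$;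 3. $\mathcal K\subseteq\mathcal L$. -/

import Mathlib

universe u v

/-- A right Hilbert module over a (not necessarily unital) C*-algebra `A`: a complex Banach space
`E` with a right action of `A` and an `A`-valued inner product, linear in the second variable, that
induces the norm of `E`. (Mathlib's `CStarModule` uses the opposite, left-handed, convention.)
Positivity of `⟨x, x⟩` is expressed by `⟨x, x⟩ = b* b` for some `b : A`. -/
class RightHilbertModule (A : Type u) (E : Type v) [NonUnitalCStarAlgebra A]
    [NormedAddCommGroup E] [NormedSpace ℂ E] [CompleteSpace E] where
  /-- the right action `x · a` -/
  rsmul : E → A → E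
  /-- the `A`-valued inner product `⟨x, y⟩` -/
  ip : E → E → A
  add_rsmul : ∀ x y a, rsmul (x + y) a = rsmul x a + rsmul y a
  rsmul_add : ∀ x a b, rsmul x (a + b) = rsmul x a + rsmul x b
  rsmul_mul : ∀ x a b, rsmul x (a * b) = rsmul (rsmul x a) b
  smul_rsmul : ∀ (z : ℂ) x a, rsmul (z • x) a = z • rsmul x a
  rsmul_smul : ∀ (z : ℂ) x a, rsmul x (z • a) = z • rsmul x a
  ip_add : ∀ x y z, ip x (y + z) = ip x y + ip x z
  ip_smul : ∀ (z : ℂ) x y, ip x (z • y) = z • ip x y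
  ip_rsmul : ∀ x y a, ip x (rsmul y a) = ip x y * a
  star_ip : ∀ x y, star (ip x y) = ip y x
  ip_self_nonneg : ∀ x, ∃ b : A, ip x x = star b * b
  ip_self_eq_zero : ∀ x, ip x x = 0 → x = 0
  norm_sq_eq : ∀ x, ‖x‖ ^ 2 = ‖ip x x‖

/-- The (generalised) compact operators `K(E)` of a right Hilbert module: the closed linear span, in
the operator norm, of the rank-one operators `ζ ↦ ξ ⟨η, ζ⟩`. -/
noncomputable def compactOperators (A : Type u) (E : Type v) [NonUnitalCStarAlgebra A]
    [NormedAddCommGroup E] [NormedSpace ℂ E] [CompleteSpace E] [RightHilbertModule A E] :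
    Submodule ℂ (E →L[ℂ] E) :=
  (Submodule.span ℂ {T : E →L[ℂ] E | ∃ ξ η : E, ∀ ζ : E,
    T ζ = RightHilbertModule.rsmul ξ (RightHilbertModule.ip η ζ : A)}).topologicalClosure

/-- A C*-correspondence over `A`: a right Hilbert `A`-module with a left action given by a
*-homomorphism `φ` from `A` into the adjointable operators. -/
structure CStarCorrespondence (A : Type u) [NonUnitalCStarAlgebra A] where
  /-- the underlying space -/
  carrier : Type v
  [instNormedAddCommGroup : NormedAddCommGroup carrier]
  [instNormedSpace : NormedSpace ℂ carrier]
  [instCompleteSpace : CompleteSpace carrier]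
  [instHilbert : RightHilbertModule A carrier]
  /-- the left action -/
  φ : A →ₙₐ[ℂ] (carrier →L[ℂ] carrier)
  φ_star : ∀ (a : A) (x y : carrier),
    (RightHilbertModule.ip (φ a x) y : A) = RightHilbertModule.ip x (φ (star a) y)

namespace CStarCorrespondence

variable {A : Type u} [NonUnitalCStarAlgebra A]

instance : CoeSort (CStarCorrespondence.{u, v} A) (Type v) := ⟨carrier⟩

attribute [instance] instNormedAddCommGroup instNormedSpace instCompleteSpace instHilbert

/-- The `A`-valued inner product of a C*-correspondence. -/
noncomputable def ip (X : CStarCorrespondence.{u, v} A) (x y : X) : A := RightHilbertModule.ip x y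

/-- The right action of a C*-correspondence. -/
noncomputable def rsmul (X : CStarCorrespondence.{u, v} A) (x : X) (a : A) : X := RightHilbertModule.rsmul x a

/-- `X` is proper if `A` acts on the left by compact operators. -/
def IsProper (X : CStarCorrespondence.{u, v} A) : Prop :=
  ∀ a : A, X.φ a ∈ compactOperators A X

/-- `X⁻¹(I) = {a ∈ A | ⟨X, a X⟩ ⊆ I}`. -/
def preimage (X : CStarCorrespondence.{u, v} A) (I : Set A) : Set A :=
  {a | ∀ x y : X, X.ip x (X.φ a y) ∈ I}

end CStarCorrespondence

/-- A product system over `ℤ₊^d` with coefficients in `A`. The identification `X₀ = A` is the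
unitary equivalence `zeroEquiv`. A multiplication map `u_{n,m} : X_n ⊗_A X_m → X_{n+m}` is given by
its restriction `mul n m` to simple tensors, a bilinear balanced map; that `u_{n,m}` is isometric is
`mul_ip` (the left side is `⟨x ⊗ y, x' ⊗ y'⟩ = ⟨y, ⟨x, x'⟩ y'⟩`), and for an isometry of the completed
tensor product surjectivity amounts to density of the span of the products. Equations between
elements of fibres with propositionally equal indices are stated in the disjoint union. -/
structure ProductSystem (A : Type u) [NonUnitalCStarAlgebra A] (d : ℕ) where
  /-- the fibres -/
  fibre : (Fin d → ℕ) → CStarCorrespondence.{u, v} A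
  /-- the identification of `A` with `X₀` -/
  zeroEquiv : A ≃ₗᵢ[ℂ] fibre 0
  zero_ip : ∀ a b, (fibre 0).ip (zeroEquiv a) (zeroEquiv b) = star a * b
  zero_rsmul : ∀ a b, (fibre 0).rsmul (zeroEquiv a) b = zeroEquiv (a * b)
  zero_φ : ∀ a b, (fibre 0).φ a (zeroEquiv b) = zeroEquiv (a * b)
  /-- the multiplication maps on simple tensors -/
  mul : ∀ n m, fibre n →ₗ[ℂ] fibre m →ₗ[ℂ] fibre (n + m)
  mul_balanced : ∀ n m x a y, mul n m ((fibre n).rsmul x a) y = mul n m x ((fibre m).φ a y)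
  mul_ip : ∀ n m x y x' y',
    (fibre m).ip y ((fibre m).φ ((fibre n).ip x x') y') =
      (fibre (n + m)).ip (mul n m x y) (mul n m x' y')
  mul_rsmul : ∀ n m x y a,
    mul n m x ((fibre m).rsmul y a) = (fibre (n + m)).rsmul (mul n m x y) a
  φ_mul : ∀ n m x y a, mul n m ((fibre n).φ a x) y = (fibre (n + m)).φ a (mul n m x y)
  zero_mul : ∀ m a (y : fibre m),
    (⟨0 + m, mul 0 m (zeroEquiv a) y⟩ : Σ k, fibre k) = ⟨m, (fibre m).φ a y⟩
  mul_zero : ∀ n (x : fibre n) a,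
    (⟨n + 0, mul n 0 x (zeroEquiv a)⟩ : Σ k, fibre k) = ⟨n, (fibre n).rsmul x a⟩
  mul_dense : ∀ n m, n ≠ 0 → m ≠ 0 →
    (Submodule.span ℂ {z | ∃ x y, z = mul n m x y}).topologicalClosure = ⊤
  mul_assoc : ∀ n m k x y z,
    (⟨n + m + k, mul (n + m) k (mul n m x y) z⟩ : Σ k, fibre k) =
      ⟨n + (m + k), mul n (m + k) x (mul m k y z)⟩

/-- A proper product system: all its fibres are proper. -/
structure ProperProductSystem (A : Type u) [NonUnitalCStarAlgebra A] (d : ℕ) extends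
    ProductSystem.{u, v} A d where
  proper : ∀ n, (fibre n).IsProper

/-- A subset of a C*-algebra that is a (two-sided, norm-closed) ideal. -/
def IsClosedTwoSidedIdeal {A : Type u} [NonUnitalCStarAlgebra A] (S : Set A) : Prop :=
  ∃ I : Submodule ℂ A, (I : Set A) = S ∧ IsClosed S ∧
    ∀ x ∈ S, ∀ a : A, a * x ∈ S ∧ x * a ∈ S

namespace ProperProductSystem

variable {A : Type u} [NonUnitalCStarAlgebra A] {d : ℕ}

/-- A `2^d`-tuple of `X`: a family of non-empty subsets of the coefficient algebra `A`, indexed by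
the subsets of `[d]`. -/
structure Tuple (_X : ProperProductSystem.{u, v} A d) where
  /-- the members of the family -/
  toFun : Finset (Fin d) → Set A
  nonempty : ∀ F, (toFun F).Nonempty

namespace Tuple

variable {X : ProperProductSystem.{u, v} A d}

instance : CoeFun X.Tuple (fun _ => Finset (Fin d) → Set A) := ⟨toFun⟩

/-- `K ⊆ L` means `K_F ⊆ L_F` for every `F ⊆ [d]`. -/
instance : HasSubset X.Tuple := ⟨fun K L => ∀ F, K F ⊆ L F⟩

/-- The tuple consists of ideals. -/
def ConsistsOfIdeals (L : X.Tuple) : Prop := ∀ F, IsClosedTwoSidedIdeal (L F)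

/-- T-families: `L` consists of ideals and `L_F = X_i⁻¹(L_F) ∩ L_{F ∪ {i}}` for all `F ⊊ [d]` and
`i ∈ [d] \ F`. -/
def IsTFamily (L : X.Tuple) : Prop :=
  L.ConsistsOfIdeals ∧
    ∀ F : Finset (Fin d), F ⊂ Finset.univ → ∀ i, i ∉ F →
      L F = (X.fibre (Pi.single i 1)).preimage (L F) ∩ L (insert i F)

/-- `L.IsRelativeOFamily K`: `L` is a `K`-relative O-family, i.e. a T-family with `K ⊆ L`. -/
def IsRelativeOFamily (L K : X.Tuple) : Prop := L.IsTFamily ∧ K ⊆ L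

end Tuple

end ProperProductSystem

/-- A C*-dynamical system `(A, α, ℤ₊^d)`: a unital semigroup homomorphism from `ℤ₊^d` to the
*-endomorphisms of `A` under composition. -/
abbrev CStarDynamicalSystem (A : Type u) [NonUnitalCStarAlgebra A] (d : ℕ) :=
  Multiplicative (Fin d → ℕ) →* (A →⋆ₙₐ[ℂ] A)

namespace CStarDynamicalSystem

variable {A : Type u} [NonUnitalCStarAlgebra A] {d : ℕ}

/-- The endomorphism `α_n`. -/
def act (α : CStarDynamicalSystem A d) (n : Fin d → ℕ) : A →⋆ₙₐ[ℂ] A :=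
  α (Multiplicative.ofAdd n)

theorem act_zero (α : CStarDynamicalSystem A d) (a : A) : α.act 0 a = a := by
  have h : α.act 0 = 1 := map_one α
  rw [h]; rfl

theorem act_add (α : CStarDynamicalSystem A d) (n m : Fin d → ℕ) (a : A) :
    α.act (n + m) a = α.act n (α.act m a) := by
  have h : α.act (n + m) = α.act n * α.act m := map_mul α _ _
  rw [h]; rfl

/-- `α_n` as a bounded linear map. -/
noncomputable def actL (α : CStarDynamicalSystem A d) (n : Fin d → ℕ) : A →L[ℂ] A :=
  LinearMap.mkContinuous
    { toFun := fun a => α.act n a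
      map_add' := fun a b => map_add _ a b
      map_smul' := fun z a => map_smul _ z a } 1
    (fun a => by simpa using NonUnitalStarAlgHom.norm_apply_le (α.act n) a)

theorem actL_apply (α : CStarDynamicalSystem A d) (n : Fin d → ℕ) (a : A) :
    α.actL n a = α.act n a := rfl

theorem exists_approximateUnit (A : Type u) [NonUnitalCStarAlgebra A] :
    ∃ l : Filter A, l.IsApproximateUnit := by
  let _ := CStarAlgebra.spectralOrder A
  have := CStarAlgebra.spectralOrderedRing A
  exact ⟨_, (CStarAlgebra.increasingApproximateUnit A).toIsApproximateUnit⟩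

/-- The space `[α_n(A) A]`, the closed linear span of the products `α_n(a) b`. -/
def space (α : CStarDynamicalSystem A d) (n : Fin d → ℕ) : Submodule ℂ A :=
  (Submodule.span ℂ {x | ∃ a b : A, x = α.act n a * b}).topologicalClosure

theorem space_isClosed (α : CStarDynamicalSystem A d) (n : Fin d → ℕ) :
    IsClosed (α.space n : Set A) := Submodule.isClosed_topologicalClosure _

theorem gen_mem_space (α : CStarDynamicalSystem A d) (n : Fin d → ℕ) (a b : A) :
    α.act n a * b ∈ α.space n :=
  Submodule.le_topologicalClosure _ (Submodule.subset_span ⟨a, b, rfl⟩)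

theorem space_le_comap (α : CStarDynamicalSystem A d) (n : Fin d → ℕ) (f : A →L[ℂ] A)
    (S : Submodule ℂ A) (hS : IsClosed (S : Set A)) (h : ∀ a b, f (α.act n a * b) ∈ S)
    {x : A} (hx : x ∈ α.space n) : f x ∈ S := by
  have : α.space n ≤ S.comap (f : A →ₗ[ℂ] A) := by
    refine Submodule.topologicalClosure_minimal _ ?_ (hS.preimage f.continuous)
    refine Submodule.span_le.2 ?_
    rintro _ ⟨a, b, rfl⟩
    exact h a b
  exact this hx

theorem mul_mem_space (α : CStarDynamicalSystem A d) (n : Fin d → ℕ) {x : A}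
    (hx : x ∈ α.space n) (b : A) : x * b ∈ α.space n := by
  refine α.space_le_comap n ((ContinuousLinearMap.mul ℂ A).flip b) _ (α.space_isClosed n) ?_ hx
  intro a c
  simpa [_root_.mul_assoc] using α.gen_mem_space n a (c * b)

theorem act_mul_mem_space (α : CStarDynamicalSystem A d) (n : Fin d → ℕ) (a x : A) :
    α.act n a * x ∈ α.space n := α.gen_mem_space n a x

theorem act_mem_space (α : CStarDynamicalSystem A d) (n : Fin d → ℕ) (a : A) :
    α.act n a ∈ α.space n := by
  obtain ⟨l, hl⟩ := exists_approximateUnit A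
  have := hl.neBot
  have h : Filter.Tendsto (fun e => α.actL n (a * e)) l (nhds (α.actL n a)) :=
    ((α.actL n).continuous.tendsto a).comp (hl.tendsto_mul_left a)
  refine (α.space_isClosed n).mem_of_tendsto h (Filter.Eventually.of_forall fun e => ?_)
  have : α.actL n (a * e) = α.act n a * α.act n e := map_mul (α.act n) a e
  rw [this]
  exact α.gen_mem_space n _ _

theorem act_mul_mem_space_add (α : CStarDynamicalSystem A d) (n m : Fin d → ℕ) {x : A}
    (hx : x ∈ α.space n) (y : A) : α.act m x * y ∈ α.space (n + m) := by
  refine α.space_le_comap n (((ContinuousLinearMap.mul ℂ A).flip y).comp (α.actL m)) _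
    (α.space_isClosed _) ?_ hx
  intro a b
  have h : α.act m (α.act n a) = α.act (n + m) a := by rw [add_comm, act_add]
  have : (((ContinuousLinearMap.mul ℂ A).flip y).comp (α.actL m)) (α.act n a * b)
      = α.act (n + m) a * (α.act m b * y) := by
    simp [actL_apply, map_mul, h, _root_.mul_assoc]
  rw [this]
  exact α.gen_mem_space _ _ _

theorem mem_space_zero (α : CStarDynamicalSystem A d) (a : A) : a ∈ α.space 0 := by
  simpa [act_zero] using α.act_mem_space 0 a

instance (α : CStarDynamicalSystem A d) (n : Fin d → ℕ) : CompleteSpace (α.space n) :=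
  (α.space_isClosed n).completeSpace_coe

/-- `X_{α,n} = [α_n(A) A]` with the right Hilbert module structure inherited from `A`:
`ξ · a = ξ a` and `⟨ξ, η⟩ = ξ* η`. -/
instance hilbert (α : CStarDynamicalSystem A d) (n : Fin d → ℕ) :
    RightHilbertModule A (α.space n) where
  rsmul x a := ⟨x * a, α.mul_mem_space n x.2 a⟩
  ip x y := star (x : A) * y
  add_rsmul x y a := Subtype.ext (_root_.add_mul _ _ _)
  rsmul_add x a b := Subtype.ext (_root_.mul_add _ _ _)
  rsmul_mul x a b := Subtype.ext (_root_.mul_assoc _ _ _).symm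
  smul_rsmul z x a := Subtype.ext (smul_mul_assoc _ _ _)
  rsmul_smul z x a := Subtype.ext (mul_smul_comm _ _ _)
  ip_add x y z := _root_.mul_add _ _ _
  ip_smul z x y := mul_smul_comm _ _ _
  ip_rsmul x y a := (_root_.mul_assoc _ _ _).symm
  star_ip x y := by simp
  ip_self_nonneg x := ⟨x, rfl⟩
  ip_self_eq_zero x h := Subtype.ext ((CStarRing.star_mul_self_eq_zero_iff _).1 h)
  norm_sq_eq x := by rw [CStarRing.norm_star_mul_self, sq]; rfl

/-- The left action of `A` on `X_{α,n}`: `φ_n(a) ξ = α_n(a) ξ`. -/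
noncomputable def leftAction (α : CStarDynamicalSystem A d) (n : Fin d → ℕ) :
    A →ₙₐ[ℂ] (α.space n →L[ℂ] α.space n) where
  toFun a := ((ContinuousLinearMap.mul ℂ A (α.act n a)).comp (α.space n).subtypeL).codRestrict
    (α.space n) (fun x => α.act_mul_mem_space n a x)
  map_smul' z a := by
    ext x
    change α.act n (z • a) * (x : A) = z • (α.act n a * (x : A))
    rw [map_smul, smul_mul_assoc]
  map_zero' := by
    ext x
    change α.act n 0 * (x : A) = 0
    rw [map_zero, MulZeroClass.zero_mul]
  map_add' a b := by
    ext x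
    change α.act n (a + b) * (x : A) = α.act n a * (x : A) + α.act n b * (x : A)
    rw [map_add, _root_.add_mul]
  map_mul' a b := by
    ext x
    change α.act n (a * b) * (x : A) = α.act n a * (α.act n b * (x : A))
    rw [map_mul, _root_.mul_assoc]

theorem coe_leftAction (α : CStarDynamicalSystem A d) (n : Fin d → ℕ) (a : A) (x : α.space n) :
    (α.leftAction n a x : A) = α.act n a * x := rfl

/-- The C*-correspondence `X_{α,n}`. -/
noncomputable def correspondence (α : CStarDynamicalSystem A d) (n : Fin d → ℕ) :
    CStarCorrespondence.{u, u} A where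
  carrier := α.space n
  φ := α.leftAction n
  φ_star a x y := by
    change star (α.act n a * (x : A)) * (y : A) = star (x : A) * (α.act n (star a) * y)
    rw [star_mul, map_star, _root_.mul_assoc]

theorem correspondence_isProper (α : CStarDynamicalSystem A d) (n : Fin d → ℕ) :
    (α.correspondence n).IsProper := by
  intro a
  change α.leftAction n a ∈ compactOperators A (α.space n)
  obtain ⟨l, hl⟩ := exists_approximateUnit A
  have := hl.neBot
  have hc : Continuous (α.leftAction n) := by
    refine AddMonoidHomClass.continuous_of_bound (α.leftAction n) 1 fun b => ?_
    rw [one_mul]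
    refine ContinuousLinearMap.opNorm_le_bound _ (norm_nonneg _) fun x => ?_
    change ‖α.act n b * (x : A)‖ ≤ ‖b‖ * ‖(x : A)‖
    exact (norm_mul_le _ _).trans (mul_le_mul_of_nonneg_right
      (NonUnitalStarAlgHom.norm_apply_le (α.act n) b) (norm_nonneg _))
  have h : Filter.Tendsto (fun e => α.leftAction n (a * e)) l (nhds (α.leftAction n a)) :=
    (hc.tendsto a).comp (hl.tendsto_mul_left a)
  refine (Submodule.isClosed_topologicalClosure _).mem_of_tendsto h
    (Filter.Eventually.of_forall fun e => ?_)
  refine Submodule.le_topologicalClosure _ (Submodule.subset_span ?_)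
  refine ⟨⟨α.act n a, α.act_mem_space n a⟩, ⟨α.act n (star e), α.act_mem_space n _⟩, fun ζ => ?_⟩
  apply Subtype.ext
  change α.act n (a * e) * (ζ : A) = α.act n a * (star (α.act n (star e)) * ζ)
  rw [map_mul, map_star, star_star, _root_.mul_assoc]

/-- The product of `ξ ∈ X_{α,n}` and `η ∈ X_{α,m}` is `α_m(ξ) η ∈ X_{α,n+m}`. -/
noncomputable def productMap (α : CStarDynamicalSystem A d) (n m : Fin d → ℕ) :
    α.space n →ₗ[ℂ] α.space m →ₗ[ℂ] α.space (n + m) :=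
  LinearMap.mk₂ ℂ (fun x y => ⟨α.act m x * y, α.act_mul_mem_space_add n m x.2 y⟩)
    (fun x x' y => Subtype.ext (by simp [_root_.add_mul]))
    (fun z x y => Subtype.ext (by simp [smul_mul_assoc]))
    (fun x y y' => Subtype.ext (by simp [_root_.mul_add]))
    (fun z x y => Subtype.ext (by simp [mul_smul_comm]))

theorem coe_productMap (α : CStarDynamicalSystem A d) (n m : Fin d → ℕ) (x : α.space n)
    (y : α.space m) : (α.productMap n m x y : A) = α.act m x * y := rfl

theorem sigma_ext (α : CStarDynamicalSystem A d) {n m : Fin d → ℕ} (h : n = m)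
    (x : α.space n) (y : α.space m) (hxy : (x : A) = y) :
    (⟨n, x⟩ : Σ k, α.space k) = ⟨m, y⟩ := by
  subst h
  rw [Subtype.ext hxy]

theorem productMap_dense (α : CStarDynamicalSystem A d) (n m : Fin d → ℕ) :
    (Submodule.span ℂ {z : α.space (n + m) |
      ∃ x y, z = α.productMap n m x y}).topologicalClosure = ⊤ := by
  obtain ⟨l, hl⟩ := exists_approximateUnit A
  have := hl.neBot
  set T := (Submodule.span ℂ {z : α.space (n + m) |
      ∃ x y, z = α.productMap n m x y}).topologicalClosure with hT
  have hTc : IsClosed (T : Set (α.space (n + m))) := Submodule.isClosed_topologicalClosure _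
  set S : Submodule ℂ A := T.map (α.space (n + m)).subtype with hS
  have hSc : IsClosed (S : Set A) := by
    exact (α.space_isClosed (n + m)).isClosedEmbedding_subtypeVal.isClosedMap _ hTc
  refine Submodule.eq_top_iff'.2 fun z => ?_
  have key : (ContinuousLinearMap.id ℂ A) (z : A) ∈ S := by
    refine α.space_le_comap (n + m) _ S hSc (fun a b => ?_) z.2
    have ht : Filter.Tendsto (fun e => α.actL (n + m) (a * e) * b) l
        (nhds (α.actL (n + m) a * b)) :=
      (((α.actL (n + m)).continuous.tendsto a).comp (hl.tendsto_mul_left a)).mul_const b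
    refine hSc.mem_of_tendsto ht (Filter.Eventually.of_forall fun e => ?_)
    refine ⟨α.productMap n m ⟨α.act n a, α.act_mem_space n a⟩
      ⟨α.act m (α.act n e) * b, α.gen_mem_space m _ b⟩,
      Submodule.le_topologicalClosure _ (Submodule.subset_span ⟨_, _, rfl⟩), ?_⟩
    change α.act m (α.act n a) * (α.act m (α.act n e) * b) = α.act (n + m) (a * e) * b
    rw [add_comm n m, act_add, map_mul, map_mul, _root_.mul_assoc]
  obtain ⟨w, hw, hwz⟩ := key
  have : w = z := Subtype.ext hwz
  exact this ▸ hw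

/-- The proper product system `X_α` of a C*-dynamical system. -/
noncomputable def productSystem (α : CStarDynamicalSystem A d) :
    ProperProductSystem.{u, u} A d where
  fibre := α.correspondence
  zeroEquiv :=
    { toFun := fun a => (⟨a, α.mem_space_zero a⟩ : α.space 0)
      invFun := fun x => (show α.space 0 from x).1
      map_add' := fun _ _ => rfl
      map_smul' := fun _ _ => rfl
      left_inv := fun _ => rfl
      right_inv := fun _ => rfl
      norm_map' := fun _ => rfl }
  zero_ip := fun _ _ => rfl
  zero_rsmul := fun _ _ => rfl
  zero_φ := fun (a b : A) => by
    apply Subtype.ext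
    change α.act 0 a * b = a * b
    rw [act_zero]
  mul := α.productMap
  mul_balanced := fun n m (x : α.space n) a (y : α.space m) => by
    apply Subtype.ext
    change α.act m ((x : A) * a) * (y : A) =
      α.act m (x : A) * (α.act m a * (y : A))
    rw [map_mul, _root_.mul_assoc]
  mul_ip := fun n m (x : α.space n) (y : α.space m) (x' : α.space n) (y' : α.space m) => by
    change star (y : A) * (α.act m (star (x : A) *
      (x' : A)) * (y' : A)) =
      star (α.act m (x : A) * (y : A)) *
        (α.act m (x' : A) * (y' : A))
    simp only [map_mul, map_star, star_mul, _root_.mul_assoc]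
  mul_rsmul := fun n m (x : α.space n) (y : α.space m) a => by
    apply Subtype.ext
    exact (_root_.mul_assoc (α.act m (x : A)) (y : A) a).symm
  φ_mul := fun n m (x : α.space n) (y : α.space m) a => by
    apply Subtype.ext
    change α.act m (α.act n a * (x : A)) * (y : A) =
      α.act (n + m) a * (α.act m (x : A) * (y : A))
    rw [add_comm n m, act_add, map_mul, _root_.mul_assoc]
  zero_mul := fun m a (y : α.space m) => by
    exact α.sigma_ext (zero_add m) (α.productMap 0 m ⟨a, α.mem_space_zero a⟩ y)
      (α.leftAction m a y) rfl
  mul_zero := fun n (x : α.space n) a => by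
    refine α.sigma_ext (add_zero n) (α.productMap n 0 x ⟨a, α.mem_space_zero a⟩)
      ⟨(x : A) * a, α.mul_mem_space n x.2 a⟩ ?_
    change α.act 0 (x : A) * a = (x : A) * a
    rw [act_zero]
  mul_dense n m _ _ := α.productMap_dense n m
  mul_assoc := fun n m k (x : α.space n) (y : α.space m) (z : α.space k) => by
    refine α.sigma_ext (add_assoc n m k) (α.productMap (n + m) k (α.productMap n m x y) z)
      (α.productMap n (m + k) x (α.productMap m k y z)) ?_
    change α.act k (α.act m (x : A) * (y : A)) * (z : A) =
      α.act (m + k) (x : A) * (α.act k (y : A) * (z : A))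
    rw [add_comm m k, act_add, map_mul, _root_.mul_assoc]
  proper := α.correspondence_isProper

end CStarDynamicalSystem

namespace CStarDynamicalSystem

variable {A : Type u} [NonUnitalCStarAlgebra A] {d : ℕ}

/-! Both sides of the equivalence ask for ideals and for `K ⊆ L`, so everything reduces to
`X_{α,n}⁻¹(I) = α_n⁻¹(I)` for a closed ideal `I`, used at the generators `n = i`. In `X_{α,n}` the
coefficient `⟨ξ, a η⟩` is the product `ξ* α_n(a) η` in `A`. If `α_n(a) ∈ I`, absorption on both
sides puts every such coefficient in `I`. Conversely, `X_{α,n}` contains `α_n(A)` (`act_mem_space`),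
so the coefficients include all `α_n(b a e)` with `b, e ∈ A`; letting `e` and then `b` run along an
approximate unit of `A` recovers `α_n(a)` as a limit of limits of elements of `I`, and `I` is
closed. The approximate unit replaces the choice `ξ = η = α_n(1)`, which is available only for
unital `A`. -/

/-- For a closed two-sided ideal `S`, the preimage `X_{α,n}⁻¹(S)` is `α_n⁻¹(S)`. -/
theorem preimage_correspondence (α : CStarDynamicalSystem A d) (n : Fin d → ℕ) {S : Set A}
    (hS : IsClosedTwoSidedIdeal S) : (α.correspondence n).preimage S = α.act n ⁻¹' S := by
  obtain ⟨-, -, hc, hmul⟩ := hS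
  ext a
  constructor
  · intro h
    -- The inner product and left action of `X_{α,n}` unfold definitionally to products in `A`.
    replace h : ∀ x y : α.space n, star (x : A) * (α.act n a * y) ∈ S := h
    obtain ⟨l, hl⟩ := exists_approximateUnit A
    have := hl.neBot
    -- The right-hand factor is removed for each fixed `b`, so two successive one-variable limits
    -- suffice and no joint limit is needed.
    have hright (b : A) : α.act n (b * a) ∈ S := by
      -- The limit is taken inside the argument of `α_n` and carried over by continuity: the
      -- elements `α_n(e)` need not form an approximate unit of `A`.
      have ht : Filter.Tendsto (fun e => α.actL n (b * a * e)) l (nhds (α.actL n (b * a))) :=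
        ((α.actL n).continuous.tendsto _).comp (hl.tendsto_mul_left (b * a))
      refine hc.mem_of_tendsto ht (Filter.Eventually.of_forall fun e => ?_)
      -- With `ξ = α_n(b*)` and `η = α_n(e)`, `ξ* α_n(a) η = α_n(b a e)`; the star on `b` cancels
      -- the one in the inner product.
      simpa [actL_apply, map_mul, map_star, _root_.mul_assoc] using
        h ⟨α.act n (star b), α.act_mem_space n _⟩ ⟨α.act n e, α.act_mem_space n e⟩
    have ht : Filter.Tendsto (fun e => α.actL n (e * a)) l (nhds (α.actL n a)) :=
      ((α.actL n).continuous.tendsto a).comp (hl.tendsto_mul_right a)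
    exact hc.mem_of_tendsto ht (Filter.Eventually.of_forall hright)
  · intro h x y
    -- Absorb `y` on the right, then `x*` on the left; closedness plays no role in this direction.
    exact (hmul _ (hmul _ h y.1).2 (star x.1)).1

end CStarDynamicalSystem

theorem corollaryC {A : Type u} [NonUnitalCStarAlgebra A] {d : ℕ}
    (α : CStarDynamicalSystem A d) (K L : α.productSystem.Tuple) :
    L.IsRelativeOFamily K ↔
      (∀ F, IsClosedTwoSidedIdeal (L F)) ∧
      (∀ F : Finset (Fin d), F ⊂ Finset.univ → ∀ i, i ∉ F →
        L F = α.act (Pi.single i 1) ⁻¹' L F ∩ L (insert i F)) ∧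
      K ⊆ L := by
  -- The ideal condition is kept as a hypothesis here because each direction supplies it: once as
  -- part of the T-family property, once as condition 1.
  have key (hL : ∀ F, IsClosedTwoSidedIdeal (L F)) (F : Finset (Fin d)) (i : Fin d) :
      (α.productSystem.fibre (Pi.single i 1)).preimage (L F) =
        α.act (Pi.single i 1) ⁻¹' L F :=
    α.preimage_correspondence _ (hL F)
  constructor
  · rintro ⟨⟨hL, hT⟩, hK⟩
    exact ⟨hL, fun F hF i hi => key hL F i ▸ hT F hF i hi, hK⟩
  · rintro ⟨hL, hT, hK⟩
    exact ⟨⟨hL, fun F hF i hi => (key hL F i).symm ▸ hT F hF i hi⟩, hK⟩
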